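/- Let $\mathbb T_1,\mathbb T_2\subset\mathbb R$ be time scales (non-empty closed sets), with forward jumps $\sigma_x,\sigma_y$, graininesses $\mu_x(x),\mu_y(y)$ and delta derivatives $\Delta_x,\Delta_y$; equations involving $\Delta_x,\sigma_x,\delta$ or the $u_j$ (resp. $\Delta_y,\sigma_y,\alpha$ or the $v_j$) are required at all points of $\mathbb T_1\times\mathbb T_2$ whose coordinate $x$ (resp. $y$) is not an isolated maximum of its time scale. For $\varphi:\mathbb T_1\times\mathbb T_2\to\mathbb R$, delta differentiable in $x$, put $$\delta=\tfrac12\varphi^{\Delta_x},\qquad \alpha=\tfrac12(\varphi+\varphi^{\sigma_y}),$$ and consider the Lax pair $\Psi^{\Delta_x}=U\Psi$, $\Psi^{\Delta_y}=V\Psi$ with $U=u_0+\zeta u_1$, $V=v_0+\zeta^{-1}v_1$, $$u_0=\tfrac{\sin\mu_x\delta}{\mu_x}\,e_2-\tfrac{1-\cos\mu_x\delta}{\mu_x},\quad u_1=-e_3,\quad v_0=0,\quad v_1=\tfrac14\,(e_3\cos\alpha+e_1\sin\alpha),$$ where $e_k=-i\sigma_k$ ($\sigma_k$ the Pauli matrices)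 and, for $\mu_x=0$, the two quotients are read as $\delta$ and $0$. Let $\kappa_1\in\mathbb R\setminus\{0\}$ and let $\theta:\mathbb T_1\times\mathbb T_2\to\mathbb R$ be delta differentiable in $x$, such that, with $P=\tfrac12(I+\sigma_1\sin\theta+\sigma_3\cos\theta)$, at least one of the following holds: (a) $\ker P=\operatorname{span}\,\Psi(i\kappa_1)c$ and $\operatorname{im}P=\operatorname{span}\,\Psi(-i\kappa_1)c^\perp$ on $\mathbb T_1\times\mathbb T_2$, where $c\in\mathbb C^2$ is a constant vector and $\Psi(\pm i\kappa_1)$ are matrix solutions of the Lax pair at $\zeta=\pm i\kappa_1$; (b) $\theta$ is delta differentiable in $x$ and $y$ and satisfies $$\tfrac1{\mu_x}\sin\!\big(\mu_x\delta-\tfrac{\theta^{\sigma_x}-\theta}2\big)=\kappa_1\sin\tfrac{\theta^{\sigma_x}+\theta}2\ (\mu_x\ne0),\qquad \delta-\tfrac12\theta^{\Delta_x}=\kappa_1\sin\tfrac{\theta^{\sigma_x}+\theta}2\ (\mu_x=0),$$ $$\tfrac1{\mu_y}\sin\tfrac{\theta^{\sigma_y}-\theta}2=\tfrac1{4\kappa_1}\sin\!\big(\alpha-\tfrac{\theta+\theta^{\sigma_y}}2\big)\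 (\mu_y\neq0),\qquad \theta^{\Delta_y}=\tfrac1{2\kappa_1}\sin(\alpha-\theta)\ (\mu_y=0).$$ Let $A=i(I-2P)=e_3\cos\theta+e_1\sin\theta$. For a second potential $\tilde\varphi$, delta differentiable in $x$, with corresponding $\tilde\alpha,\tilde\delta,\tilde u_j,\tilde v_j$, the Darboux–Bäcklund transformation $\varphi\mapsto\tilde\varphi$ is $$\tilde u_1=u_1,\quad \tilde u_0=u_0+\kappa_1(u_1A-A^{\sigma_x}u_1),\quad \tilde v_0=v_0,\quad \tilde v_1=A^{\sigma_y}v_1A^{-1}.\tag{DBT}$$ Then: 1. (DBT) is equivalent to the system $$\tilde\alpha=-\alpha+\theta^{\sigma_y}+\theta,\qquad \tilde\delta+\delta=\theta^{\Delta_x},\tag{S}$$ where $\alpha$ and $\mu_x\delta$ are regarded as angles: the first equation is taken modulo $2\pi$, the second one modulo $2\pi/\mu_x$ where $\mu_x\ne0$ and exactly where $\mu_x=0$. In particular, the exact system (S) implies (DBT). 2. The exact system (S) holds if and only if $\tilde\varphi=2\theta-\varphi+\chi$ on $\mathbb T_1\times\mathbb T_2$ for some function $\chi=\chi(y)$ with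 $\chi^{\sigma_y}=-\chi$. Likewise, (DBT) holds if and only if $\tilde\varphi\equiv2\theta-\varphi+\chi \pmod{4\pi}$ on $\mathbb T_1\times\mathbb T_2$ for some $\chi=\chi(y)$ with $\chi^{\sigma_y}\equiv-\chi\pmod{4\pi}$. 3. Such a $\chi$ is inessential: if $\chi=\chi(y)$ and $\chi^{\sigma_y}=-\chi$, then replacing any potential $\psi$ by $\psi+\chi$ does not change the matrices $U,V$ of the Lax pair. Thus, up to $\chi$, the transformation reduces to $\tilde\varphi=2\theta-\varphi$. -/

import Mathlib

open Filter Topology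

noncomputable section

namespace TimeScaleSG

/-! ### Calculus on time scales -/

/-- A time scale: a non-empty closed subset of the real line. -/
structure IsTimeScale (T : Set ℝ) : Prop where
  isClosed : IsClosed T
  nonempty : T.Nonempty

open Classical in
/-- The forward jump operator `t ↦ inf {s ∈ T : s > t}`, with the usual convention that it fixes
the maximum of `T` (if there is one). -/
def jump (T : Set ℝ) (t : ℝ) : ℝ :=
  if ∃ s ∈ T, t < s then sInf {s | s ∈ T ∧ t < s} else t

/-- The graininess. -/
def grain (T : Set ℝ) (t : ℝ) : ℝ := jump T t - t

/-- The points of `T` at which delta derivatives are determined: all points of `T` except an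
isolated maximum. -/
def kappaSet (T : Set ℝ) : Set ℝ :=
  {t | t ∈ T ∧ ((∃ s ∈ T, t < s) ∨ AccPt t (𝓟 T))}

section Delta

variable {E : Type*} [AddCommGroup E] [Module ℝ E] [TopologicalSpace E]

/-- `f' = lim_{s → t} (f (t^σ) - f s) / (t^σ - s)`, where `s` runs through the points of `T` other
than `t^σ` (so `s = t` is allowed when `t` is right-scattered). -/
def HasDeltaDerivAt (T : Set ℝ) (f : ℝ → E) (f' : E) (t : ℝ) : Prop :=
  Tendsto (fun s : ℝ => (jump T t - s)⁻¹ • (f (jump T t) - f s)) (𝓝[T \ {jump T t}] t) (𝓝 f')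

def DeltaDifferentiableAt (T : Set ℝ) (f : ℝ → E) (t : ℝ) : Prop :=
  ∃ f' : E, HasDeltaDerivAt T f f' t

open Classical in
/-- The delta derivative (`0` where it does not exist). -/
def deltaDeriv (T : Set ℝ) (f : ℝ → E) (t : ℝ) : E :=
  if h : ∃ f' : E, HasDeltaDerivAt T f f' t then h.choose else 0

end Delta

/-! Functions of `(x, y) ∈ T₁ × T₂` are written as functions on `ℝ × ℝ` of which only the values on
`T₁ × T₂` are ever used. -/

/-- `f^{σ_x}` -/
def shiftX {E : Type*} (T₁ : Set ℝ) (f : ℝ → ℝ → E) (x y : ℝ) : E := f (jump T₁ x) y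

/-- `f^{σ_y}` -/
def shiftY {E : Type*} (T₂ : Set ℝ) (f : ℝ → ℝ → E) (x y : ℝ) : E := f x (jump T₂ y)

/-- `f^{Δ_x}` -/
def derivX (T₁ : Set ℝ) (f : ℝ → ℝ → ℝ) (x y : ℝ) : ℝ := deltaDeriv T₁ (fun s => f s y) x

/-- `f^{Δ_y}` -/
def derivY (T₂ : Set ℝ) (f : ℝ → ℝ → ℝ) (x y : ℝ) : ℝ := deltaDeriv T₂ (fun s => f x s) y

/-- `f` is delta differentiable in `x`. -/
def DifferentiableX (T₁ T₂ : Set ℝ) (f : ℝ → ℝ → ℝ) : Prop :=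
  ∀ x ∈ kappaSet T₁, ∀ y ∈ T₂, DeltaDifferentiableAt T₁ (fun s => f s y) x

/-- `f` is delta differentiable in `y`. -/
def DifferentiableY (T₁ T₂ : Set ℝ) (f : ℝ → ℝ → ℝ) : Prop :=
  ∀ x ∈ T₁, ∀ y ∈ kappaSet T₂, DeltaDifferentiableAt T₂ (fun s => f x s) y

/-! ### The Lax pair -/

/-- `2 × 2` complex matrices. -/
abbrev Mat := Matrix (Fin 2) (Fin 2) ℂ

def pauli1 : Mat := !![0, 1; 1, 0]
def pauli2 : Mat := !![0, -Complex.I; Complex.I, 0]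
def pauli3 : Mat := !![1, 0; 0, -1]

def e1 : Mat := (-Complex.I) • pauli1
def e2 : Mat := (-Complex.I) • pauli2
def e3 : Mat := (-Complex.I) • pauli3

/-- `δ = φ^{Δ_x} / 2` -/
def delta (T₁ : Set ℝ) (φ : ℝ → ℝ → ℝ) (x y : ℝ) : ℝ := derivX T₁ φ x y / 2

/-- `α = (φ + φ^{σ_y}) / 2` -/
def alpha (T₂ : Set ℝ) (φ : ℝ → ℝ → ℝ) (x y : ℝ) : ℝ := (φ x y + shiftY T₂ φ x y) / 2

/-- `sin (μ d) / μ`, read as its limit `d` for `μ = 0`. -/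
def sinQuot (μ d : ℝ) : ℝ := if μ = 0 then d else Real.sin (μ * d) / μ

/-- `(1 - cos (μ d)) / μ`, read as its limit `0` for `μ = 0`. -/
def cosQuot (μ d : ℝ) : ℝ := if μ = 0 then 0 else (1 - Real.cos (μ * d)) / μ

/-- The matrix `U` of the Lax pair. -/
def laxU (T₁ : Set ℝ) (φ : ℝ → ℝ → ℝ) (ζ : ℂ) (x y : ℝ) : Mat :=
  (Complex.I * ζ) • pauli3
    - ((sinQuot (grain T₁ x) (delta T₁ φ x y) : ℂ) * Complex.I) • pauli2
    - (cosQuot (grain T₁ x) (delta T₁ φ x y) : ℂ) • (1 : Mat)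

/-- The matrix `V` of the Lax pair. -/
def laxV (T₂ : Set ℝ) (φ : ℝ → ℝ → ℝ) (ζ : ℂ) (x y : ℝ) : Mat :=
  (1 / (4 * Complex.I * ζ)) •
    ((Real.cos (alpha T₂ φ x y) : ℂ) • pauli3 + (Real.sin (alpha T₂ φ x y) : ℂ) • pauli1)

/-- `Ψ` solves `Ψ^{Δ_x} = U Ψ`, `Ψ^{Δ_y} = V Ψ` at the spectral parameter `ζ`. -/
def SolvesLaxPair (T₁ T₂ : Set ℝ) (φ : ℝ → ℝ → ℝ) (ζ : ℂ) (Ψ : ℝ → ℝ → Mat) : Prop :=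
  (∀ x ∈ kappaSet T₁, ∀ y ∈ T₂,
    HasDeltaDerivAt T₁ (fun s => Ψ s y) (laxU T₁ φ ζ x y * Ψ x y) x) ∧
  (∀ x ∈ T₁, ∀ y ∈ kappaSet T₂,
    HasDeltaDerivAt T₂ (fun s => Ψ x s) (laxV T₂ φ ζ x y * Ψ x y) y)

/-- The coefficients of a linear problem with `U = u₀ + ζ u₁`, `V = v₀ + ζ⁻¹ v₁`. -/
structure LaxCoeffs where
  u0 : ℝ → ℝ → Mat
  u1 : ℝ → ℝ → Mat
  v0 : ℝ → ℝ → Mat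
  v1 : ℝ → ℝ → Mat

/-- The coefficients of the sine-Gordon Lax pair with potential `φ`. -/
def laxCoeffs (T₁ T₂ : Set ℝ) (φ : ℝ → ℝ → ℝ) : LaxCoeffs where
  u0 x y := (sinQuot (grain T₁ x) (delta T₁ φ x y) : ℂ) • e2
    - (cosQuot (grain T₁ x) (delta T₁ φ x y) : ℂ) • (1 : Mat)
  u1 _ _ := -e3
  v0 _ _ := 0
  v1 x y := (1 / 4 : ℂ) •
    ((Real.cos (alpha T₂ φ x y) : ℂ) • e3 + (Real.sin (alpha T₂ φ x y) : ℂ) • e1)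

theorem laxU_eq (T₁ T₂ : Set ℝ) (φ : ℝ → ℝ → ℝ) (ζ : ℂ) (x y : ℝ) :
    laxU T₁ φ ζ x y = (laxCoeffs T₁ T₂ φ).u0 x y + ζ • (laxCoeffs T₁ T₂ φ).u1 x y := by
  simp only [laxU, laxCoeffs, e2, e3, smul_smul, neg_smul, smul_neg]
  rw [mul_comm Complex.I ζ]
  abel

theorem laxV_eq (T₁ T₂ : Set ℝ) (φ : ℝ → ℝ → ℝ) (ζ : ℂ) (x y : ℝ) :
    laxV T₂ φ ζ x y = (laxCoeffs T₁ T₂ φ).v0 x y + ζ⁻¹ • (laxCoeffs T₁ T₂ φ).v1 x y := by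
  simp only [laxV, laxCoeffs, e1, e3, smul_smul, smul_add, zero_add, one_div, mul_inv,
    Complex.inv_I]
  congr 2 <;> ring

/-! ### The Darboux–Bäcklund transformation -/

/-- The Hermitian projector `P = (I + σ₁ sin θ + σ₃ cos θ) / 2`. -/
def projP (θ : ℝ) : Mat :=
  (1 / 2 : ℂ) • (1 + (Real.sin θ : ℂ) • pauli1 + (Real.cos θ : ℂ) • pauli3)

/-- `A = i (I - 2 P)`. -/
def darbouxA (θ : ℝ → ℝ → ℝ) (x y : ℝ) : Mat := Complex.I • (1 - (2 : ℂ) • projP (θ x y))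

theorem darbouxA_eq (θ : ℝ → ℝ → ℝ) (x y : ℝ) :
    darbouxA θ x y = (Real.cos (θ x y) : ℂ) • e3 + (Real.sin (θ x y) : ℂ) • e1 := by
  ext i j
  fin_cases i <;> fin_cases j <;> simp [darbouxA, projP, e1, e3, pauli1, pauli3] <;> ring

/-- The Darboux–Bäcklund transformation `L ↦ L'` of the coefficients of the linear problem. -/
structure IsDBT (T₁ T₂ : Set ℝ) (κ : ℝ) (θ : ℝ → ℝ → ℝ) (L L' : LaxCoeffs) : Prop where
  u1_eq : ∀ x ∈ kappaSet T₁, ∀ y ∈ T₂, L'.u1 x y = L.u1 x y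
  u0_eq : ∀ x ∈ kappaSet T₁, ∀ y ∈ T₂, L'.u0 x y = L.u0 x y +
    (κ : ℂ) • (L.u1 x y * darbouxA θ x y - shiftX T₁ (darbouxA θ) x y * L.u1 x y)
  v0_eq : ∀ x ∈ T₁, ∀ y ∈ kappaSet T₂, L'.v0 x y = L.v0 x y
  v1_eq : ∀ x ∈ T₁, ∀ y ∈ kappaSet T₂,
    L'.v1 x y = shiftY T₂ (darbouxA θ) x y * L.v1 x y * (darbouxA θ x y)⁻¹

/-- `c^⊥`: the vector of `ℂ²` (unique up to a factor) orthogonal to `c` for the Hermitian product. -/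
def perp (c : Fin 2 → ℂ) : Fin 2 → ℂ := ![-star (c 1), star (c 0)]

/-- `θ` is determined by the Lax pair with potential `φ` through
`ker P = Ψ(iκ) c`, `im P = Ψ(-iκ) c^⊥`, with a constant vector `c`. -/
def IsKernelTheta (T₁ T₂ : Set ℝ) (κ : ℝ) (φ θ : ℝ → ℝ → ℝ) : Prop :=
  ∃ (Ψ : ℂ → ℝ → ℝ → Mat) (c : Fin 2 → ℂ),
    SolvesLaxPair T₁ T₂ φ (Complex.I * κ) (Ψ (Complex.I * κ)) ∧
    SolvesLaxPair T₁ T₂ φ (-(Complex.I * κ)) (Ψ (-(Complex.I * κ))) ∧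
    ∀ x ∈ T₁, ∀ y ∈ T₂,
      LinearMap.ker (Matrix.toLin' (projP (θ x y))) =
        Submodule.span ℂ {(Ψ (Complex.I * κ) x y).mulVec c} ∧
      LinearMap.range (Matrix.toLin' (projP (θ x y))) =
        Submodule.span ℂ {(Ψ (-(Complex.I * κ)) x y).mulVec (perp c)}

/-- `θ` solves the dynamic equations for the parameter of the projector `P`. -/
structure IsDynTheta (T₁ T₂ : Set ℝ) (κ : ℝ) (φ θ : ℝ → ℝ → ℝ) : Prop where
  differentiableX : DifferentiableX T₁ T₂ θ
  differentiableY : DifferentiableY T₁ T₂ θ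
  x_scattered : ∀ x ∈ kappaSet T₁, ∀ y ∈ T₂, grain T₁ x ≠ 0 →
    1 / grain T₁ x *
        Real.sin (grain T₁ x * delta T₁ φ x y - (shiftX T₁ θ x y - θ x y) / 2) =
      κ * Real.sin ((shiftX T₁ θ x y + θ x y) / 2)
  y_scattered : ∀ x ∈ T₁, ∀ y ∈ kappaSet T₂, grain T₂ y ≠ 0 →
    1 / grain T₂ y * Real.sin ((shiftY T₂ θ x y - θ x y) / 2) =
      1 / (4 * κ) * Real.sin (alpha T₂ φ x y - (θ x y + shiftY T₂ θ x y) / 2)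
  x_dense : ∀ x ∈ kappaSet T₁, ∀ y ∈ T₂, grain T₁ x = 0 →
    delta T₁ φ x y - derivX T₁ θ x y / 2 = κ * Real.sin ((shiftX T₁ θ x y + θ x y) / 2)
  y_dense : ∀ x ∈ T₁, ∀ y ∈ kappaSet T₂, grain T₂ y = 0 →
    derivY T₂ θ x y = 1 / (2 * κ) * Real.sin (alpha T₂ φ x y - θ x y)

/-- The system `α̃ = -α + θ^{σ_y} + θ`, `δ̃ + δ = θ^{Δ_x}`. -/
structure IsSystem (T₁ T₂ : Set ℝ) (φ φ' θ : ℝ → ℝ → ℝ) : Prop where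
  alpha_eq : ∀ x ∈ T₁, ∀ y ∈ kappaSet T₂,
    alpha T₂ φ' x y = -alpha T₂ φ x y + shiftY T₂ θ x y + θ x y
  delta_eq : ∀ x ∈ kappaSet T₁, ∀ y ∈ T₂,
    delta T₁ φ' x y + delta T₁ φ x y = derivX T₁ θ x y

/-- The same system, read for the angles `α` and `μ_x δ` modulo `2π`: the first equation is taken
modulo `2π`, and the second one modulo `2π / μ_x` where `μ_x ≠ 0` and exactly where `μ_x = 0`. -/
structure IsSystemMod (T₁ T₂ : Set ℝ) (φ φ' θ : ℝ → ℝ → ℝ) : Prop where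
  alpha_eq : ∀ x ∈ T₁, ∀ y ∈ kappaSet T₂, ∃ n : ℤ,
    alpha T₂ φ' x y = -alpha T₂ φ x y + shiftY T₂ θ x y + θ x y + 2 * Real.pi * n
  delta_dense : ∀ x ∈ kappaSet T₁, ∀ y ∈ T₂, grain T₁ x = 0 →
    delta T₁ φ' x y + delta T₁ φ x y = derivX T₁ θ x y
  delta_scattered : ∀ x ∈ kappaSet T₁, ∀ y ∈ T₂, grain T₁ x ≠ 0 → ∃ n : ℤ,
    delta T₁ φ' x y + delta T₁ φ x y = derivX T₁ θ x y + 2 * Real.pi / grain T₁ x * n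

end TimeScaleSG

end

/-!
The transformation acts on `u₀` and `v₁` only, and both conditions are relations between angles.

* `A` and `v₁` are multiples of reflections `σ₃ cos a + σ₁ sin a`, and a product of three
  reflections is the reflection with the alternating sum of the angles (`darboux_v1`). So the
  condition on `v₁` is the first equation of the system modulo `2π`, whatever `θ` is.
* The condition on `u₀` involves `κ sin θ`, which has to be eliminated by the first-order equation
  `XEquation` for `θ` in the `x` direction. This equation is either assumed (`IsDynTheta.xEquation`)
  or follows from the description of `ker P` (`IsKernelTheta.xEquation`): the vector
  `v = Ψ(iκ) c` is orthogonal to `(cos (θ / 2), sin (θ / 2))`, and the equation is the shift of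
  this relation at right-scattered points and its derivative at right-dense ones. Then
  product-to-sum formulas turn the condition on `u₀` into the second equation of the system
  (`u0_eq_iff_delta`).

For the relation between the potentials, put `g = φ̃ + φ - 2 θ`. The system says that `g^{Δ_x}`
vanishes and that `g^{σ_y} = -g`, so the point is that a function with vanishing delta derivative
is constant on a time scale (`eq_of_zero_deltaDeriv`). Modulo `4π` the derivative of `g` vanishes
at right-dense points, and `g` jumps by multiples of `4π` at right-scattered ones; the constancy
theorem is then applied to `cos ((g - g a) / 2)` (`exists_eq_add_four_pi_mul`). In the converse
direction, a differentiable function with values in `χ + 4πℤ` has derivative zero at right-dense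
points.
-/

namespace TimeScaleSG

/-! ### The forward jump -/

theorem le_jump (T : Set ℝ) (t : ℝ) : t ≤ jump T t := by
  unfold jump
  split_ifs with h
  · obtain ⟨s, hs, hts⟩ := h
    exact le_csInf ⟨s, hs, hts⟩ fun r hr => hr.2.le
  · exact le_rfl

theorem jump_le {T : Set ℝ} {s t : ℝ} (hs : s ∈ T) (hts : t < s) : jump T t ≤ s := by
  unfold jump
  rw [if_pos ⟨s, hs, hts⟩]
  exact csInf_le ⟨t, fun r hr => hr.2.le⟩ ⟨hs, hts⟩

theorem jump_mem_closure {T : Set ℝ} {t : ℝ} (h : ∃ s ∈ T, t < s) :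
    jump T t ∈ closure {s | s ∈ T ∧ t < s} := by
  unfold jump
  rw [if_pos h]
  obtain ⟨s, hs, hts⟩ := h
  exact csInf_mem_closure ⟨s, hs, hts⟩ ⟨t, fun r hr => hr.2.le⟩

theorem jump_mem {T : Set ℝ} (hT : IsClosed T) {t : ℝ} (ht : t ∈ T) : jump T t ∈ T := by
  by_cases h : ∃ s ∈ T, t < s
  · exact closure_minimal (fun r hr => hr.1) hT (jump_mem_closure h)
  · unfold jump
    rwa [if_neg h]

theorem grain_eq_zero_iff {T : Set ℝ} {t : ℝ} : grain T t = 0 ↔ jump T t = t := sub_eq_zero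

/-- Delta derivatives are determined at the points of `kappaSet T`. -/
theorem neBot_of_mem_kappaSet {T : Set ℝ} {t : ℝ} (ht : t ∈ kappaSet T) :
    (𝓝[T \ {jump T t}] t).NeBot := by
  obtain ⟨htT, h⟩ := ht
  by_cases hj : jump T t = t
  · rw [hj]
    rcases h with h | h
    · have h1 := jump_mem_closure h
      rw [hj] at h1
      refine mem_closure_iff_nhdsWithin_neBot.1 (closure_mono ?_ h1)
      exact fun r hr => ⟨hr.1, hr.2.ne'⟩
    · exact mem_closure_iff_nhdsWithin_neBot.1
        (mem_closure_iff_clusterPt.2 (accPt_principal_iff_clusterPt.1 h))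
  · have hmem : t ∈ T \ {jump T t} := ⟨htT, fun h => hj h.symm⟩
    exact mem_closure_iff_nhdsWithin_neBot.1 (subset_closure hmem)

/-! ### Delta derivatives -/

section Delta

variable {E F : Type*} [AddCommGroup E] [Module ℝ E] [TopologicalSpace E]
  [AddCommGroup F] [Module ℝ F] [TopologicalSpace F] {T : Set ℝ} {t : ℝ}

theorem HasDeltaDerivAt.unique [T2Space E] {f : ℝ → E} {a b : E} (ht : t ∈ kappaSet T)
    (ha : HasDeltaDerivAt T f a t) (hb : HasDeltaDerivAt T f b t) : a = b := by
  have := neBot_of_mem_kappaSet ht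
  exact tendsto_nhds_unique ha hb

theorem DeltaDifferentiableAt.hasDeltaDerivAt {f : ℝ → E} (h : DeltaDifferentiableAt T f t) :
    HasDeltaDerivAt T f (deltaDeriv T f t) t := by
  unfold deltaDeriv
  rw [dif_pos (show ∃ f' : E, HasDeltaDerivAt T f f' t from h)]
  exact Exists.choose_spec (show ∃ f' : E, HasDeltaDerivAt T f f' t from h)

theorem HasDeltaDerivAt.map {f : ℝ → E} {a : E} (h : HasDeltaDerivAt T f a t)
    (L : E →ₗ[ℝ] F) (hL : Continuous L) : HasDeltaDerivAt T (fun s => L (f s)) (L a) t := by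
  have := (hL.tendsto a).comp h
  refine this.congr fun s => ?_
  simp

theorem hasDeltaDerivAt_iff_hasDerivWithinAt {E : Type*} [NormedAddCommGroup E] [NormedSpace ℝ E]
    {f : ℝ → E} {a : E} (hj : jump T t = t) :
    HasDeltaDerivAt T f a t ↔ HasDerivWithinAt f a T t := by
  unfold HasDeltaDerivAt
  rw [hasDerivWithinAt_iff_tendsto_slope, hj]
  refine tendsto_congr fun s => ?_
  rw [slope_comm, slope_def_module]

/-- At a right-scattered point the defining limit includes the difference quotient at the point
itself. -/
theorem HasDeltaDerivAt.sub_eq [T1Space E] {f : ℝ → E} {a : E} (h : HasDeltaDerivAt T f a t)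
    (ht : t ∈ T) (hj : jump T t ≠ t) : f (jump T t) - f t = grain T t • a := by
  have hmem : t ∈ T \ {jump T t} := ⟨ht, fun h => hj h.symm⟩
  have h1 : pure t ≤ 𝓝[T \ {jump T t}] t := pure_le_nhdsWithin hmem
  have h2 := tendsto_pure_left.1 (h.mono_left h1)
  have h3 : (jump T t - t)⁻¹ • (f (jump T t) - f t) = a := by
    by_contra hne
    exact h2 {x | x ≠ (jump T t - t)⁻¹ • (f (jump T t) - f t)}
      (isOpen_ne.mem_nhds (fun h => hne h.symm)) rfl
  rw [← h3, grain, smul_inv_smul₀ (sub_ne_zero.2 hj)]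

theorem HasDeltaDerivAt.continuousWithinAt {E : Type*} [NormedAddCommGroup E] [NormedSpace ℝ E]
    {f : ℝ → E} {a : E} (h : HasDeltaDerivAt T f a t) (ht : t ∈ T) :
    ContinuousWithinAt f T t := by
  by_cases hj : jump T t = t
  · exact ((hasDeltaDerivAt_iff_hasDerivWithinAt hj).1 h).continuousWithinAt
  · have hs := h.sub_eq ht hj
    have h1 : Tendsto (fun s => jump T t - s) (𝓝[T \ {jump T t}] t) (𝓝 (jump T t - t)) :=
      (Continuous.tendsto (by fun_prop) t).mono_left nhdsWithin_le_nhds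
    have h2 := tendsto_const_nhds (x := f (jump T t)) |>.sub (h1.smul h)
    have h3 : f (jump T t) - (jump T t - t) • a = f t := by
      rw [← grain, ← hs]; abel
    rw [h3] at h2
    have h4 : ContinuousWithinAt f (T \ {jump T t}) t := by
      refine Tendsto.congr' ?_ h2
      filter_upwards [self_mem_nhdsWithin] with s hsT
      rw [smul_inv_smul₀ (sub_ne_zero.2 fun h => hsT.2 h.symm)]
      abel
    refine h4.mono_of_mem_nhdsWithin ?_
    exact inter_mem_nhdsWithin T (isOpen_ne.mem_nhds fun h => hj h.symm)

theorem HasDeltaDerivAt.congr {f g : ℝ → E} {a : E} (hT : IsClosed T) (ht : t ∈ T)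
    (h : HasDeltaDerivAt T f a t) (hfg : ∀ s ∈ T, g s = f s) : HasDeltaDerivAt T g a t := by
  refine Tendsto.congr' ?_ h
  filter_upwards [self_mem_nhdsWithin] with s hs
  rw [hfg s hs.1, hfg _ (jump_mem hT ht)]

theorem HasDeltaDerivAt.add_sub_two_mul {f g k : ℝ → ℝ} {a b c : ℝ} (hf : HasDeltaDerivAt T f a t)
    (hg : HasDeltaDerivAt T g b t) (hk : HasDeltaDerivAt T k c t) :
    HasDeltaDerivAt T (fun s => f s + g s - 2 * k s) (a + b - 2 * c) t := by
  refine ((Tendsto.add hf hg).sub (Tendsto.const_mul 2 hk)).congr fun s => ?_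
  simp only [smul_eq_mul]
  ring

theorem hasDeltaDerivAt_const (c : ℝ) : HasDeltaDerivAt T (fun _ => c) 0 t := by
  refine Tendsto.congr (fun s => ?_) tendsto_const_nhds
  simp

end Delta

/-- A function on a closed set with vanishing delta derivative is constant: for `ε > 0`, the
infimum of the points `t ≥ a` at which `|g t - g a| ≤ ε (t - a)` fails would be a right-dense
point at which the bound holds, and there the derivative extends the bound to the right. -/
theorem eq_of_zero_deltaDeriv_of_le {T : Set ℝ} (hT : IsClosed T) {g : ℝ → ℝ}
    (hd : ∀ t ∈ kappaSet T, jump T t = t → HasDerivWithinAt g 0 T t)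
    (hs : ∀ t ∈ kappaSet T, g (jump T t) = g t)
    (hc : ∀ t ∈ kappaSet T, ContinuousWithinAt g T t) {a b : ℝ} (ha : a ∈ T) (hb : b ∈ T)
    (hab : a ≤ b) : g b = g a := by
  have key : ∀ ε > 0, |g b - g a| ≤ ε * (b - a) := by
    intro ε hε
    by_contra hbad
    let B : Set ℝ := {t | t ∈ T ∧ a ≤ t ∧ ¬ |g t - g a| ≤ ε * (t - a)}
    have hB : B.Nonempty := ⟨b, hb, hab, hbad⟩
    have hBb : BddBelow B := ⟨a, fun t ht => ht.2.1⟩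
    set m := sInf B with hm
    have hmB : m ∈ closure B := csInf_mem_closure hB hBb
    have hmT : m ∈ T := closure_minimal (fun t ht => ht.1) hT hmB
    have ham : a ≤ m := le_csInf hB fun t ht => ht.2.1
    have hlt : ∀ t ∈ T, a ≤ t → t < m → |g t - g a| ≤ ε * (t - a) := by
      intro t ht hat htm
      by_contra h
      exact absurd (csInf_le hBb (show t ∈ B from ⟨ht, hat, h⟩)) (not_le.2 htm)
    have hgood : |g m - g a| ≤ ε * (m - a) := by
      rcases ham.eq_or_lt with h | ham'
      · rw [← h]; simp
      let S : Set ℝ := {t | t ∈ T ∧ a ≤ t ∧ t < m}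
      have hS : S.Nonempty := ⟨a, ha, le_rfl, ham'⟩
      have hSb : BddAbove S := ⟨m, fun t ht => ht.2.2.le⟩
      have hrS : sSup S ∈ closure S := csSup_mem_closure hS hSb
      have hrT : sSup S ∈ T := closure_minimal (fun t ht => ht.1) hT hrS
      have har : a ≤ sSup S := le_csSup hSb ⟨ha, le_rfl, ham'⟩
      rcases (csSup_le hS fun t ht => ht.2.2.le : sSup S ≤ m).eq_or_lt with h | hrm
      · -- `m` is a limit of good points from the left
        rw [h] at hrS
        have hSm : S ⊆ T \ {m} := fun t ht => ⟨ht.1, ht.2.2.ne⟩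
        have hmk : m ∈ kappaSet T := by
          refine ⟨hmT, Or.inr ?_⟩
          rw [accPt_principal_iff_clusterPt, ← mem_closure_iff_clusterPt]
          exact closure_mono hSm hrS
        have hne := mem_closure_iff_nhdsWithin_neBot.1 hrS
        have hcont : Tendsto g (𝓝[S] m) (𝓝 (g m)) :=
          (hc m hmk).mono fun t ht => ht.1
        have hid : Tendsto (fun t : ℝ => ε * (t - a)) (𝓝[S] m) (𝓝 (ε * (m - a))) :=
          (Continuous.tendsto (by fun_prop) m).mono_left nhdsWithin_le_nhds
        refine le_of_tendsto_of_tendsto (hcont.sub_const (g a)).abs hid ?_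
        filter_upwards [self_mem_nhdsWithin] with t ht
        exact hlt t ht.1 ht.2.1 ht.2.2
      · -- `m` is the forward jump of a good point
        have hrk : sSup S ∈ kappaSet T := ⟨hrT, Or.inl ⟨m, hmT, hrm⟩⟩
        have hjump : jump T (sSup S) = m := by
          refine le_antisymm (jump_le hmT hrm) (not_lt.1 fun hlt' => ?_)
          have h1 : jump T (sSup S) ∈ S :=
            ⟨jump_mem hT hrT, har.trans (le_jump _ _), hlt'⟩
          have h2 : jump T (sSup S) = sSup S :=
            le_antisymm (le_csSup hSb h1) (le_jump _ _)
          have h3 := jump_mem_closure ⟨m, hmT, hrm⟩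
          rw [h2] at h3
          obtain ⟨q, hqm, hq⟩ := mem_closure_iff.1 h3 (Set.Iio m) isOpen_Iio hrm
          exact absurd (le_csSup hSb ⟨hq.1, har.trans hq.2.le, hqm⟩) (not_le.2 hq.2)
        have h1 := hs _ hrk
        rw [hjump] at h1
        rw [h1]
        refine (hlt _ hrT har hrm).trans ?_
        gcongr
    have hmB' : m ∉ B := fun h => h.2.2 hgood
    have hgt : ∀ t ∈ B, m < t := fun t ht =>
      lt_of_le_of_ne (csInf_le hBb ht) fun h => hmB' (h ▸ ht)
    obtain ⟨t₀, ht₀⟩ := hB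
    have hmk : m ∈ kappaSet T := ⟨hmT, Or.inl ⟨t₀, ht₀.1, hgt t₀ ht₀⟩⟩
    have hjm : jump T m = m := by
      refine le_antisymm (not_lt.1 fun h => ?_) (le_jump _ _)
      obtain ⟨q, hqm, hq⟩ := mem_closure_iff.1 hmB (Set.Iio (jump T m)) isOpen_Iio h
      exact absurd (jump_le hq.1 (hgt q hq)) (not_le.2 hqm)
    have hder := (hd m hmk hjm).hasFDerivWithinAt.isLittleO.def hε
    rw [eventually_nhdsWithin_iff] at hder
    obtain ⟨q, hq, hqB⟩ := mem_closure_iff_nhds.1 hmB _ hder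
    have h1 := hq hqB.1
    have h2 := hgt q hqB
    simp only [ContinuousLinearMap.toSpanSingleton_apply, smul_zero, sub_zero,
      Real.norm_eq_abs, abs_of_pos (sub_pos.2 h2)] at h1
    refine hqB.2.2 ?_
    calc |g q - g a| ≤ |g q - g m| + |g m - g a| := abs_sub_le _ _ _
      _ ≤ ε * (q - m) + ε * (m - a) := add_le_add h1 hgood
      _ = ε * (q - a) := by ring
  have h0 : |g b - g a| ≤ 0 := by
    have hlim : Tendsto (fun ε : ℝ => ε * (b - a)) (𝓝[>] 0) (𝓝 (0 * (b - a))) :=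
      (Continuous.tendsto (by fun_prop) 0).mono_left nhdsWithin_le_nhds
    rw [zero_mul] at hlim
    exact ge_of_tendsto hlim (by filter_upwards [self_mem_nhdsWithin] with ε hε using key ε hε)
  exact sub_eq_zero.1 (abs_nonpos_iff.1 h0)

theorem eq_of_zero_deltaDeriv {T : Set ℝ} (hT : IsClosed T) {g : ℝ → ℝ}
    (hd : ∀ t ∈ kappaSet T, jump T t = t → HasDerivWithinAt g 0 T t)
    (hs : ∀ t ∈ kappaSet T, g (jump T t) = g t)
    (hc : ∀ t ∈ kappaSet T, ContinuousWithinAt g T t) {a b : ℝ} (ha : a ∈ T) (hb : b ∈ T) :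
    g b = g a := by
  rcases le_total a b with h | h
  · exact eq_of_zero_deltaDeriv_of_le hT hd hs hc ha hb h
  · exact (eq_of_zero_deltaDeriv_of_le hT hd hs hc hb ha h).symm

/-- A delta differentiable `g` that is stationary at right-dense points and jumps by multiples of
`4π` at right-scattered ones is constant modulo `4π`: the function `cos ((g - g a) / 2)` has
vanishing delta derivative. -/
theorem exists_eq_add_four_pi_mul {T : Set ℝ} (hT : IsClosed T) {g g' : ℝ → ℝ}
    (hg : ∀ t ∈ kappaSet T, HasDeltaDerivAt T g (g' t) t)
    (hd : ∀ t ∈ kappaSet T, jump T t = t → g' t = 0)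
    (hs : ∀ t ∈ kappaSet T, jump T t ≠ t → ∃ n : ℤ, grain T t * g' t = 4 * Real.pi * n)
    {a b : ℝ} (ha : a ∈ T) (hb : b ∈ T) : ∃ n : ℤ, g b = g a + 4 * Real.pi * n := by
  have h : Real.cos ((g b - g a) / 2) = Real.cos ((g a - g a) / 2) := by
    refine eq_of_zero_deltaDeriv hT (g := fun t => Real.cos ((g t - g a) / 2)) ?_ ?_ ?_ ha hb
    · intro t ht hj
      have h1 := (hasDeltaDerivAt_iff_hasDerivWithinAt hj).1 (hg t ht)
      simpa [hd t ht hj] using ((h1.sub_const (g a)).div_const 2).cos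
    · intro t ht
      by_cases hj : jump T t = t
      · rw [hj]
      · obtain ⟨n, hn⟩ := hs t ht hj
        have h1 := (hg t ht).sub_eq ht.1 hj
        rw [smul_eq_mul, hn] at h1
        have h2 : (g (jump T t) - g a) / 2 = (g t - g a) / 2 + n * (2 * Real.pi) := by linarith
        simp only [h2, Real.cos_add_int_mul_two_pi]
    · intro t ht
      have h1 := (hg t ht).continuousWithinAt ht.1
      exact Real.continuous_cos.continuousAt.comp_continuousWithinAt
        ((h1.sub continuousWithinAt_const).div_const 2)
  rw [sub_self, zero_div, Real.cos_zero, Real.cos_eq_one_iff] at h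
  obtain ⟨n, hn⟩ := h
  exact ⟨n, by linarith⟩

/-! ### The equation for the projector in the `x` direction -/

theorem sin_eq_and_cos_eq_iff (a b : ℝ) :
    (Real.sin a = Real.sin b ∧ Real.cos a = Real.cos b) ↔ ∃ n : ℤ, a = b + 2 * Real.pi * n := by
  constructor
  · rintro ⟨h1, h2⟩
    have h : Real.cos (a - b) = 1 := by
      rw [Real.cos_sub, h1, h2]
      nlinarith [Real.sin_sq_add_cos_sq b]
    obtain ⟨n, hn⟩ := (Real.cos_eq_one_iff _).1 h
    exact ⟨n, by linarith⟩
  · rintro ⟨n, rfl⟩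
    rw [mul_comm (2 * Real.pi) (n : ℝ)]
    exact ⟨Real.sin_add_int_mul_two_pi b n, Real.cos_add_int_mul_two_pi b n⟩

/-- The first-order equation in `x` for the angle `θ` at one point, common to the two ways of
determining the projector `P`. -/
def XEquation (T₁ : Set ℝ) (κ : ℝ) (φ θ : ℝ → ℝ → ℝ) (x y : ℝ) : Prop :=
  (jump T₁ x ≠ x →
    Real.sin (grain T₁ x * delta T₁ φ x y - (θ (jump T₁ x) y - θ x y) / 2) =
      grain T₁ x * κ * Real.sin ((θ (jump T₁ x) y + θ x y) / 2)) ∧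
  (jump T₁ x = x → delta T₁ φ x y - derivX T₁ θ x y / 2 = κ * Real.sin (θ x y))

theorem IsDynTheta.xEquation {T₁ T₂ : Set ℝ} {κ : ℝ} {φ θ : ℝ → ℝ → ℝ}
    (h : IsDynTheta T₁ T₂ κ φ θ) {x y : ℝ} (hx : x ∈ kappaSet T₁) (hy : y ∈ T₂) :
    XEquation T₁ κ φ θ x y := by
  constructor
  · intro hj
    have hμ : grain T₁ x ≠ 0 := fun h => hj (grain_eq_zero_iff.1 h)
    have h1 := h.x_scattered x hx y hy hμ
    simp only [shiftX] at h1
    field_simp at h1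
    convert h1 using 2
    all_goals ring_nf
  · intro hj
    have h1 := h.x_dense x hx y hy (grain_eq_zero_iff.2 hj)
    rwa [shiftX, hj, add_self_div_two] at h1

/-- The kernel of the projector `P` is the line orthogonal to `(cos (θ / 2), sin (θ / 2))`. -/
theorem mem_ker_projP {θ : ℝ} {v : Fin 2 → ℂ} :
    v ∈ LinearMap.ker (Matrix.toLin' (projP θ)) ↔
      (Real.cos (θ / 2) : ℂ) * v 0 + (Real.sin (θ / 2) : ℂ) * v 1 = 0 := by
  have hc : (Real.cos θ : ℂ) = 2 * (Real.cos (θ / 2) : ℂ) ^ 2 - 1 := by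
    have := Real.cos_sq (θ / 2)
    rw [show 2 * (θ / 2) = θ by ring] at this
    rw [show Real.cos θ = 2 * Real.cos (θ / 2) ^ 2 - 1 by rw [this]; ring]
    push_cast; ring
  have hs : (Real.sin θ : ℂ) = 2 * (Real.sin (θ / 2) : ℂ) * (Real.cos (θ / 2) : ℂ) := by
    have := Real.sin_two_mul (θ / 2)
    rw [show 2 * (θ / 2) = θ by ring] at this
    rw [this]; push_cast; ring
  have h1 : (Real.sin (θ / 2) : ℂ) ^ 2 + (Real.cos (θ / 2) : ℂ) ^ 2 = 1 := by
    exact_mod_cast Real.sin_sq_add_cos_sq (θ / 2)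
  have h00 : (projP θ).mulVec v 0 = (Real.cos (θ / 2) : ℂ) *
      ((Real.cos (θ / 2) : ℂ) * v 0 + (Real.sin (θ / 2) : ℂ) * v 1) := by
    simp only [projP, pauli1, pauli3, Matrix.mulVec, dotProduct, Fin.sum_univ_two, hc, hs]
    simp [-Complex.ofReal_sin, -Complex.ofReal_cos]
    ring
  have h11 : (projP θ).mulVec v 1 = (Real.sin (θ / 2) : ℂ) *
      ((Real.cos (θ / 2) : ℂ) * v 0 + (Real.sin (θ / 2) : ℂ) * v 1) := by
    simp only [projP, pauli1, pauli3, Matrix.mulVec, dotProduct, Fin.sum_univ_two, hc, hs]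
    simp [-Complex.ofReal_sin, -Complex.ofReal_cos]
    linear_combination (-v 1) * h1
  rw [LinearMap.mem_ker, Matrix.toLin'_apply]
  generalize (Real.cos (θ / 2) : ℂ) * v 0 + (Real.sin (θ / 2) : ℂ) * v 1 = w at *
  constructor
  · intro h
    rw [h, Pi.zero_apply] at h00 h11
    linear_combination (-w) * h1 - (Real.sin (θ / 2) : ℂ) * h11 - (Real.cos (θ / 2) : ℂ) * h00
  · rintro rfl
    ext i
    fin_cases i
    · simpa using h00
    · simpa using h11

/-- A vector spanning the kernel of `P` is a non-zero multiple of `(-sin (θ / 2), cos (θ / 2))`. -/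
theorem exists_of_ker_projP_eq_span {θ : ℝ} {v : Fin 2 → ℂ}
    (h : LinearMap.ker (Matrix.toLin' (projP θ)) = Submodule.span ℂ {v}) :
    ∃ r : ℂ, r ≠ 0 ∧ v 0 = -r * (Real.sin (θ / 2) : ℂ) ∧ v 1 = r * (Real.cos (θ / 2) : ℂ) := by
  have h1 : (Real.sin (θ / 2) : ℂ) ^ 2 + (Real.cos (θ / 2) : ℂ) ^ 2 = 1 := by
    exact_mod_cast Real.sin_sq_add_cos_sq (θ / 2)
  have hv : v ∈ LinearMap.ker (Matrix.toLin' (projP θ)) := by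
    rw [h]; exact Submodule.mem_span_singleton_self v
  rw [mem_ker_projP] at hv
  have hw : ![-(Real.sin (θ / 2) : ℂ), (Real.cos (θ / 2) : ℂ)] ∈
      LinearMap.ker (Matrix.toLin' (projP θ)) := by
    rw [mem_ker_projP]; simp; ring
  rw [h, Submodule.mem_span_singleton] at hw
  obtain ⟨q, hq⟩ := hw
  have hq0 := congrFun hq 0
  have hq1 := congrFun hq 1
  simp only [Pi.smul_apply, smul_eq_mul, Matrix.cons_val_zero, Matrix.cons_val_one] at hq0 hq1
  refine ⟨(Real.cos (θ / 2) : ℂ) * v 1 - (Real.sin (θ / 2) : ℂ) * v 0, ?_, ?_, ?_⟩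
  · intro h0
    have : (1 : ℂ) = 0 := by
      rw [← h1]
      linear_combination q * h0 - (Real.cos (θ / 2) : ℂ) * hq1 + (Real.sin (θ / 2) : ℂ) * hq0
    exact one_ne_zero this
  · linear_combination (-v 0) * h1 + (Real.cos (θ / 2) : ℂ) * hv
  · linear_combination (-v 1) * h1 + (Real.sin (θ / 2) : ℂ) * hv

/-- At `ζ = iκ` the matrix `U` is real. -/
theorem laxU_mulVec (T₁ : Set ℝ) (φ : ℝ → ℝ → ℝ) (κ x y : ℝ) (v : Fin 2 → ℂ) :
    (laxU T₁ φ (Complex.I * κ) x y).mulVec v =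
      ![-(κ : ℂ) * v 0 - (sinQuot (grain T₁ x) (delta T₁ φ x y) : ℂ) * v 1
          - (cosQuot (grain T₁ x) (delta T₁ φ x y) : ℂ) * v 0,
        (κ : ℂ) * v 1 + (sinQuot (grain T₁ x) (delta T₁ φ x y) : ℂ) * v 0
          - (cosQuot (grain T₁ x) (delta T₁ φ x y) : ℂ) * v 1] := by
  have hI := Complex.I_mul_I
  ext i
  fin_cases i
  · simp [laxU, pauli2, pauli3, Matrix.mulVec, dotProduct, Fin.sum_univ_two]
    linear_combination ((κ : ℂ) * v 0 +
      (sinQuot (grain T₁ x) (delta T₁ φ x y) : ℂ) * v 1) * hI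
  · simp [laxU, pauli2, pauli3, Matrix.mulVec, dotProduct, Fin.sum_univ_two]
    linear_combination (-(κ : ℂ) * v 1 -
      (sinQuot (grain T₁ x) (delta T₁ φ x y) : ℂ) * v 0) * hI

/-- If `ker P` is spanned by `v = Ψ(iκ) c`, then `(cos (θ / 2), sin (θ / 2)) · v = 0`; its shift
(at right-scattered points) or its derivative (at right-dense ones) is the equation for `θ`. -/
theorem IsKernelTheta.xEquation {T₁ T₂ : Set ℝ} (hT₁ : IsClosed T₁) {κ : ℝ} {φ θ : ℝ → ℝ → ℝ}
    (hθ : DifferentiableX T₁ T₂ θ) (h : IsKernelTheta T₁ T₂ κ φ θ) {x y : ℝ}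
    (hx : x ∈ kappaSet T₁) (hy : y ∈ T₂) : XEquation T₁ κ φ θ x y := by
  obtain ⟨Ψ, c, hΨ, -, hP⟩ := h
  set v : ℝ → Fin 2 → ℂ := fun s => (Ψ (Complex.I * κ) s y).mulVec c with hv
  have hker : ∀ s ∈ T₁,
      (Real.cos (θ s y / 2) : ℂ) * v s 0 + (Real.sin (θ s y / 2) : ℂ) * v s 1 = 0 := by
    intro s hs
    rw [← mem_ker_projP, (hP s hs y hy).1]
    exact Submodule.mem_span_singleton_self _
  obtain ⟨r, hr, hr0, hr1⟩ := exists_of_ker_projP_eq_span (hP x hx.1 y hy).1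
  change v x 0 = _ at hr0
  change v x 1 = _ at hr1
  have hder : ∀ i, HasDeltaDerivAt T₁ (fun s => v s i)
      ((laxU T₁ φ (Complex.I * κ) x y).mulVec (v x) i) x := by
    intro i
    let L : Mat →ₗ[ℝ] ℂ :=
      { toFun := fun M => M.mulVec c i
        map_add' := fun M N => by simp [Matrix.add_mulVec]
        map_smul' := fun a M => by simp [Matrix.smul_mulVec] }
    have hL : Continuous L := by
      change Continuous fun M : Mat => M.mulVec c i
      fun_prop
    have := (hΨ.1 x hx y hy).map L hL
    rwa [hv, Matrix.mulVec_mulVec]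
  have h0 := hder 0
  have h1 := hder 1
  simp only [laxU_mulVec, Matrix.cons_val_zero, Matrix.cons_val_one] at h0 h1
  have hsq : (Real.sin (θ x y / 2) : ℂ) ^ 2 + (Real.cos (θ x y / 2) : ℂ) ^ 2 = 1 := by
    exact_mod_cast Real.sin_sq_add_cos_sq (θ x y / 2)
  constructor
  · intro hj
    have hμ : grain T₁ x ≠ 0 := fun h => hj (grain_eq_zero_iff.1 h)
    have hμ' : (grain T₁ x : ℂ) ≠ 0 := by exact_mod_cast hμ
    have e0 := h0.sub_eq hx.1 hj
    have e1 := h1.sub_eq hx.1 hj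
    have hk := hker _ (jump_mem hT₁ hx.1)
    simp only [sinQuot, cosQuot, if_neg hμ, Complex.real_smul] at e0 e1
    rw [hr0, hr1] at e0 e1
    push_cast at e0 e1
    field_simp at e0 e1
    have key : (r : ℂ) * ((Real.sin (grain T₁ x * delta T₁ φ x y -
        (θ (jump T₁ x) y - θ x y) / 2) : ℝ) -
        ((grain T₁ x * κ * Real.sin ((θ (jump T₁ x) y + θ x y) / 2) : ℝ) : ℂ)) = 0 := by
      rw [show (θ (jump T₁ x) y - θ x y) / 2 = θ (jump T₁ x) y / 2 - θ x y / 2 by ring,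
        show (θ (jump T₁ x) y + θ x y) / 2 = θ (jump T₁ x) y / 2 + θ x y / 2 by ring,
        Real.sin_sub, Real.sin_sub, Real.cos_sub, Real.sin_add]
      push_cast at hk ⊢
      linear_combination (-1 : ℂ) * hk + Complex.cos (θ (jump T₁ x) y / 2) * e0 +
        Complex.sin (θ (jump T₁ x) y / 2) * e1
    have := (mul_eq_zero.1 key).resolve_left hr
    exact_mod_cast sub_eq_zero.1 this
  · intro hj
    have hμ : grain T₁ x = 0 := grain_eq_zero_iff.2 hj
    rw [hasDeltaDerivAt_iff_hasDerivWithinAt hj] at h0 h1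
    have hθ' := (hasDeltaDerivAt_iff_hasDerivWithinAt hj).1 (hθ x hx y hy).hasDeltaDerivAt
    have hcos := ((hθ'.div_const 2).cos).ofReal_comp
    have hsin := ((hθ'.div_const 2).sin).ofReal_comp
    have hsum := (hcos.mul h0).add (hsin.mul h1)
    have hzero := hsum.congr_of_mem (f₁ := fun _ => (0 : ℂ)) (fun s hs => (hker s hs).symm) hx.1
    have heq := ((hasDeltaDerivAt_iff_hasDerivWithinAt hj).2 hzero).unique hx
      ((hasDeltaDerivAt_iff_hasDerivWithinAt hj).2 (hasDerivWithinAt_const x T₁ (0 : ℂ)))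
    change _ = _ at heq
    simp only [sinQuot, cosQuot, if_pos hμ] at heq
    rw [hr0, hr1] at heq
    have key : (r : ℂ) * ((delta T₁ φ x y - derivX T₁ θ x y / 2 : ℝ) -
        ((κ * Real.sin (θ x y) : ℝ) : ℂ)) = 0 := by
      rw [show Real.sin (θ x y) = 2 * Real.sin (θ x y / 2) * Real.cos (θ x y / 2) by
        rw [← Real.sin_two_mul]; congr 1; ring]
      unfold derivX
      push_cast at heq hsq ⊢
      linear_combination (-1 : ℂ) * heq - r * ((delta T₁ φ x y : ℂ) -
        ((deltaDeriv T₁ (fun s => θ s y) x : ℝ) : ℂ) / 2) * hsq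
    have := (mul_eq_zero.1 key).resolve_left hr
    exact_mod_cast sub_eq_zero.1 this

/-! ### The transformation in terms of angles -/

theorem darbouxA_inv (θ : ℝ → ℝ → ℝ) (x y : ℝ) : (darbouxA θ x y)⁻¹ = -darbouxA θ x y := by
  have hsq : (Real.sin (θ x y) : ℂ) ^ 2 + (Real.cos (θ x y) : ℂ) ^ 2 = 1 := by
    exact_mod_cast Real.sin_sq_add_cos_sq (θ x y)
  refine Matrix.inv_eq_right_inv ?_
  rw [darbouxA_eq]
  generalize (Real.cos (θ x y) : ℂ) = c at *
  generalize (Real.sin (θ x y) : ℂ) = s at *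
  have hI := Complex.I_mul_I
  ext i j
  fin_cases i <;> fin_cases j <;>
    simp [e1, e3, pauli1, pauli3, Matrix.mul_apply, Fin.sum_univ_two] <;>
    first | ring1 | linear_combination hsq - (c ^ 2 + s ^ 2) * hI

/-- Three reflections compose to a reflection, which gives the conjugate of `v₁`. -/
theorem darboux_v1 (a b c : ℝ) :
    ((Real.cos a : ℂ) • e3 + (Real.sin a : ℂ) • e1) *
      ((1 / 4 : ℂ) • ((Real.cos b : ℂ) • e3 + (Real.sin b : ℂ) • e1)) *
      -((Real.cos c : ℂ) • e3 + (Real.sin c : ℂ) • e1) =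
    (1 / 4 : ℂ) • ((Real.cos (-b + a + c) : ℂ) • e3 + (Real.sin (-b + a + c) : ℂ) • e1) := by
  have hI := Complex.I_mul_I
  simp only [Real.cos_add, Real.sin_add, Real.cos_neg, Real.sin_neg]
  push_cast
  generalize Complex.cos a = ca
  generalize Complex.sin a = sa
  generalize Complex.cos b = cb
  generalize Complex.sin b = sb
  generalize Complex.cos c = cc
  generalize Complex.sin c = sc
  have hI3 : Complex.I ^ 3 = -Complex.I := by simp [pow_succ]
  ext i j
  fin_cases i <;> fin_cases j <;>
    simp [e1, e3, pauli1, pauli3, Matrix.mul_apply, Fin.sum_univ_two] <;> ring_nf <;>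
    simp only [hI3] <;> ring

theorem reflection_eq_iff (a b : ℝ) :
    (1 / 4 : ℂ) • ((Real.cos a : ℂ) • e3 + (Real.sin a : ℂ) • e1) =
      (1 / 4 : ℂ) • ((Real.cos b : ℂ) • e3 + (Real.sin b : ℂ) • e1) ↔
    ∃ n : ℤ, a = b + 2 * Real.pi * n := by
  rw [← sin_eq_and_cos_eq_iff]
  constructor
  · intro h
    have h00 := congrFun (congrFun h 0) 0
    have h01 := congrFun (congrFun h 0) 1
    simp [e1, e3, pauli1, pauli3, -Complex.ofReal_sin, -Complex.ofReal_cos] at h00 h01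
    exact ⟨h01, h00⟩
  · rintro ⟨h1, h2⟩
    rw [h1, h2]

/-- The transformation of `u₀`, entry by entry. -/
theorem u0_eq_iff (s s' c c' κ a b : ℝ) :
    (s' : ℂ) • e2 - (c' : ℂ) • (1 : Mat) = (s : ℂ) • e2 - (c : ℂ) • (1 : Mat) +
      (κ : ℂ) • (-e3 * ((Real.cos a : ℂ) • e3 + (Real.sin a : ℂ) • e1) -
        ((Real.cos b : ℂ) • e3 + (Real.sin b : ℂ) • e1) * -e3) ↔
    s' = s - κ * (Real.sin a + Real.sin b) ∧ c' = c + κ * (Real.cos b - Real.cos a) := by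
  have hI := Complex.I_mul_I
  constructor
  · intro h
    have h00 := congrFun (congrFun h 0) 0
    have h01 := congrFun (congrFun h 0) 1
    simp [e1, e2, e3, pauli1, pauli2, pauli3,
      -Complex.ofReal_sin, -Complex.ofReal_cos] at h00 h01
    constructor
    · have : ((s' : ℝ) : ℂ) = ((s - κ * (Real.sin a + Real.sin b) : ℝ) : ℂ) := by
        push_cast at *
        linear_combination -h01 +
          (κ : ℂ) * (Complex.sin a + Complex.sin b) * hI
      exact_mod_cast this
    · have : ((c' : ℝ) : ℂ) = ((c + κ * (Real.cos b - Real.cos a) : ℝ) : ℂ) := by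
        push_cast at *
        linear_combination -h00 + (κ : ℂ) * (Complex.cos a - Complex.cos b) * hI
      exact_mod_cast this
  · rintro ⟨rfl, rfl⟩
    ext i j
    fin_cases i <;> fin_cases j <;>
      simp [e1, e2, e3, pauli1, pauli2, pauli3] <;>
      ring_nf <;> simp only [Complex.I_sq] <;> ring

/-- Given the equation for `θ`, the transformation of `u₀` is the relation of angles: by
product-to-sum formulas, it prescribes sine and cosine of `μ δ̃` to be those of
`θ^σ - θ - μ δ`. -/
theorem u0_eq_iff_delta {T₁ T₂ : Set ℝ} {κ : ℝ} {φ φ' θ : ℝ → ℝ → ℝ}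
    (hθ : DifferentiableX T₁ T₂ θ) {x y : ℝ} (hx : x ∈ kappaSet T₁) (hy : y ∈ T₂)
    (h : XEquation T₁ κ φ θ x y) :
    (laxCoeffs T₁ T₂ φ').u0 x y = (laxCoeffs T₁ T₂ φ).u0 x y +
        (κ : ℂ) • ((laxCoeffs T₁ T₂ φ).u1 x y * darbouxA θ x y -
          shiftX T₁ (darbouxA θ) x y * (laxCoeffs T₁ T₂ φ).u1 x y) ↔
      (grain T₁ x = 0 → delta T₁ φ' x y + delta T₁ φ x y = derivX T₁ θ x y) ∧
      (grain T₁ x ≠ 0 → ∃ n : ℤ,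
        delta T₁ φ' x y + delta T₁ φ x y = derivX T₁ θ x y + 2 * Real.pi / grain T₁ x * n) := by
  simp only [laxCoeffs, shiftX, darbouxA_eq]
  rw [u0_eq_iff]
  by_cases hμ : grain T₁ x = 0
  · have hj := grain_eq_zero_iff.1 hμ
    have h1 := h.2 hj
    simp only [sinQuot, cosQuot, hμ, hj, if_true, sub_self, mul_zero, add_zero, and_true,
      true_imp_iff, ne_eq, not_true_eq_false, false_imp_iff]
    constructor <;> intro h2 <;> linarith
  · have hj : jump T₁ x ≠ x := fun h => hμ (grain_eq_zero_iff.2 h)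
    have h1 := h.1 hj
    have h2 := (hθ x hx y hy).hasDeltaDerivAt.sub_eq hx.1 hj
    simp only [smul_eq_mul] at h2
    change _ = grain T₁ x * derivX T₁ θ x y at h2
    simp only [sinQuot, cosQuot, if_neg hμ]
    simp only [hμ, false_imp_iff, true_and, ne_eq, not_false_eq_true, true_imp_iff]
    have h3 : (∃ n : ℤ, delta T₁ φ' x y + delta T₁ φ x y =
          derivX T₁ θ x y + 2 * Real.pi / grain T₁ x * n) ↔
        ∃ n : ℤ, grain T₁ x * delta T₁ φ' x y =
          (θ (jump T₁ x) y - θ x y - grain T₁ x * delta T₁ φ x y) + 2 * Real.pi * n := by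
      refine exists_congr fun n => ?_
      rw [h2]
      field_simp
      constructor <;> intro h4 <;> linarith
    rw [h3, ← sin_eq_and_cos_eq_iff]
    generalize grain T₁ x * delta T₁ φ' x y = a'
    generalize grain T₁ x * delta T₁ φ x y = a at *
    generalize grain T₁ x = μ at *
    obtain ⟨p, hp⟩ : ∃ p, p = (θ (jump T₁ x) y + θ x y) / 2 := ⟨_, rfl⟩
    obtain ⟨q, hq⟩ : ∃ q, q = (θ (jump T₁ x) y - θ x y) / 2 := ⟨_, rfl⟩
    rw [← hp, ← hq] at h1
    rw [show θ (jump T₁ x) y = p + q by rw [hp, hq]; ring, show θ x y = p - q by rw [hp, hq]; ring]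
    have hS : Real.sin (p + q - (p - q) - a) =
        Real.sin a - μ * κ * (Real.sin (p - q) + Real.sin (p + q)) := by
      have e : Real.sin (p - q) + Real.sin (p + q) = 2 * Real.sin p * Real.cos q := by
        rw [Real.sin_add, Real.sin_sub]; ring
      rw [e, show μ * κ * (2 * Real.sin p * Real.cos q) =
        2 * (μ * κ * Real.sin p) * Real.cos q by ring, ← h1,
        show p + q - (p - q) - a = q - (a - q) by ring, Real.sin_sub q]
      nth_rewrite 3 [show a = (a - q) + q by ring]
      rw [Real.sin_add]; ring
    have hC : Real.cos (p + q - (p - q) - a) =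
        Real.cos a - μ * κ * (Real.cos (p + q) - Real.cos (p - q)) := by
      have e : Real.cos (p + q) - Real.cos (p - q) = -2 * Real.sin p * Real.sin q := by
        rw [Real.cos_add, Real.cos_sub]; ring
      rw [e, show μ * κ * (-2 * Real.sin p * Real.sin q) =
        -2 * (μ * κ * Real.sin p) * Real.sin q by ring, ← h1,
        show p + q - (p - q) - a = q - (a - q) by ring, Real.cos_sub q]
      nth_rewrite 3 [show a = (a - q) + q by ring]
      rw [Real.cos_add]; ring
    rw [hS, hC]
    field_simp
    refine and_congr ?_ ?_
    · constructor <;> intro h4 <;> linarith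
    · constructor <;> intro h4 <;> linarith

/-! ### The system and the relation between the potentials -/

section System

variable {T₁ T₂ : Set ℝ} {φ φ' θ : ℝ → ℝ → ℝ}

theorem isDBT_iff_isSystemMod {κ : ℝ} (hθ : DifferentiableX T₁ T₂ θ)
    (h : ∀ x ∈ kappaSet T₁, ∀ y ∈ T₂, XEquation T₁ κ φ θ x y) :
    IsDBT T₁ T₂ κ θ (laxCoeffs T₁ T₂ φ) (laxCoeffs T₁ T₂ φ') ↔ IsSystemMod T₁ T₂ φ φ' θ := by
  have hv : ∀ x y, (laxCoeffs T₁ T₂ φ').v1 x y =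
      shiftY T₂ (darbouxA θ) x y * (laxCoeffs T₁ T₂ φ).v1 x y * (darbouxA θ x y)⁻¹ ↔
      ∃ n : ℤ, alpha T₂ φ' x y =
        -alpha T₂ φ x y + shiftY T₂ θ x y + θ x y + 2 * Real.pi * n := by
    intro x y
    rw [darbouxA_inv, shiftY, darbouxA_eq, darbouxA_eq]
    simp only [laxCoeffs]
    rw [darboux_v1, reflection_eq_iff]
    rfl
  constructor
  · intro hD
    refine ⟨fun x hx y hy => (hv x y).1 (hD.v1_eq x hx y hy), fun x hx y hy => ?_,
      fun x hx y hy => ?_⟩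
    · exact ((u0_eq_iff_delta hθ hx hy (h x hx y hy)).1 (hD.u0_eq x hx y hy)).1
    · exact ((u0_eq_iff_delta hθ hx hy (h x hx y hy)).1 (hD.u0_eq x hx y hy)).2
  · intro hS
    refine ⟨fun _ _ _ _ => rfl, fun x hx y hy => ?_, fun _ _ _ _ => rfl,
      fun x hx y hy => (hv x y).2 (hS.alpha_eq x hx y hy)⟩
    exact (u0_eq_iff_delta hθ hx hy (h x hx y hy)).2
      ⟨hS.delta_dense x hx y hy, hS.delta_scattered x hx y hy⟩

theorem IsSystem.isSystemMod (h : IsSystem T₁ T₂ φ φ' θ) : IsSystemMod T₁ T₂ φ φ' θ where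
  alpha_eq x hx y hy := ⟨0, by simpa using h.alpha_eq x hx y hy⟩
  delta_dense x hx y hy _ := h.delta_eq x hx y hy
  delta_scattered x hx y hy _ := ⟨0, by simpa using h.delta_eq x hx y hy⟩

/-- The delta derivative of `φ̃ + φ - 2 θ` is twice the defect of the second equation of the
system. -/
theorem hasDeltaDerivAt_defect (hφ : DifferentiableX T₁ T₂ φ) (hφ' : DifferentiableX T₁ T₂ φ')
    (hθ : DifferentiableX T₁ T₂ θ) {x y : ℝ} (hx : x ∈ kappaSet T₁) (hy : y ∈ T₂) :
    HasDeltaDerivAt T₁ (fun s => φ' s y + φ s y - 2 * θ s y)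
      (2 * (delta T₁ φ' x y + delta T₁ φ x y - derivX T₁ θ x y)) x := by
  have := (hφ' x hx y hy).hasDeltaDerivAt.add_sub_two_mul (hφ x hx y hy).hasDeltaDerivAt
    (hθ x hx y hy).hasDeltaDerivAt
  convert this using 1
  simp only [delta, derivX]
  ring

theorem isSystem_iff (hT₁ : IsTimeScale T₁) (hT₂ : IsTimeScale T₂)
    (hφ : DifferentiableX T₁ T₂ φ) (hφ' : DifferentiableX T₁ T₂ φ')
    (hθ : DifferentiableX T₁ T₂ θ) :
    IsSystem T₁ T₂ φ φ' θ ↔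
      ∃ χ : ℝ → ℝ, (∀ y ∈ kappaSet T₂, χ (jump T₂ y) = -χ y) ∧
        ∀ x ∈ T₁, ∀ y ∈ T₂, φ' x y = 2 * θ x y - φ x y + χ y := by
  constructor
  · intro hS
    obtain ⟨x₀, hx₀⟩ := hT₁.nonempty
    refine ⟨fun y => φ' x₀ y + φ x₀ y - 2 * θ x₀ y, fun y hy => ?_, fun x hx y hy => ?_⟩
    · have := hS.alpha_eq x₀ hx₀ y hy
      simp only [alpha, shiftY] at this
      linarith
    · have hg : ∀ t ∈ kappaSet T₁,
          HasDeltaDerivAt T₁ (fun s => φ' s y + φ s y - 2 * θ s y) 0 t := by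
        intro t ht
        have := hasDeltaDerivAt_defect hφ hφ' hθ ht hy
        rwa [hS.delta_eq t ht y hy, sub_self, mul_zero] at this
      have := eq_of_zero_deltaDeriv hT₁.isClosed
        (fun t ht hj => (hasDeltaDerivAt_iff_hasDerivWithinAt hj).1 (hg t ht))
        (fun t ht => ?_) (fun t ht => (hg t ht).continuousWithinAt ht.1) hx₀ hx
      · linarith
      · by_cases hj : jump T₁ t = t
        · rw [hj]
        · have := (hg t ht).sub_eq ht.1 hj
          rw [smul_zero] at this
          exact sub_eq_zero.1 this
  · rintro ⟨χ, hχ, h⟩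
    constructor
    · intro x hx y hy
      simp only [alpha, shiftY]
      rw [h x hx y hy.1, h x hx _ (jump_mem hT₂.isClosed hy.1), hχ y hy]
      ring
    · intro x hx y hy
      have h1 := hasDeltaDerivAt_defect hφ hφ' hθ hx hy
      have h2 := (hasDeltaDerivAt_const (T := T₁) (t := x) (χ y)).congr hT₁.isClosed hx.1
        (g := fun s => φ' s y + φ s y - 2 * θ s y) fun s hs => by rw [h s hs y hy]; ring
      have := h1.unique hx h2
      linarith

theorem isSystemMod_iff (hT₁ : IsTimeScale T₁) (hT₂ : IsTimeScale T₂)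
    (hφ : DifferentiableX T₁ T₂ φ) (hφ' : DifferentiableX T₁ T₂ φ')
    (hθ : DifferentiableX T₁ T₂ θ) :
    IsSystemMod T₁ T₂ φ φ' θ ↔
      ∃ χ : ℝ → ℝ, (∀ y ∈ kappaSet T₂, ∃ n : ℤ, χ (jump T₂ y) = -χ y + 4 * Real.pi * n) ∧
        ∀ x ∈ T₁, ∀ y ∈ T₂, ∃ n : ℤ,
          φ' x y = 2 * θ x y - φ x y + χ y + 4 * Real.pi * n := by
  constructor
  · intro hS
    obtain ⟨x₀, hx₀⟩ := hT₁.nonempty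
    refine ⟨fun y => φ' x₀ y + φ x₀ y - 2 * θ x₀ y, fun y hy => ?_, fun x hx y hy => ?_⟩
    · obtain ⟨n, hn⟩ := hS.alpha_eq x₀ hx₀ y hy
      simp only [alpha, shiftY] at hn
      exact ⟨n, by linarith⟩
    · suffices h : ∃ n : ℤ, φ' x y + φ x y - 2 * θ x y =
          φ' x₀ y + φ x₀ y - 2 * θ x₀ y + 4 * Real.pi * n by
        obtain ⟨n, hn⟩ := h
        exact ⟨n, by linarith⟩
      refine exists_eq_add_four_pi_mul (g := fun s => φ' s y + φ s y - 2 * θ s y) hT₁.isClosed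
        (fun t ht => hasDeltaDerivAt_defect hφ hφ' hθ ht hy) ?_ ?_ hx₀ hx
      · intro t ht hj
        rw [hS.delta_dense t ht y hy (grain_eq_zero_iff.2 hj), sub_self, mul_zero]
      · intro t ht hj
        have hμ : grain T₁ t ≠ 0 := fun h => hj (grain_eq_zero_iff.1 h)
        obtain ⟨n, hn⟩ := hS.delta_scattered t ht y hy hμ
        refine ⟨n, ?_⟩
        rw [hn]
        field_simp
        ring
  · rintro ⟨χ, hχ, h⟩
    refine ⟨fun x hx y hy => ?_, fun x hx y hy hμ => ?_, fun x hx y hy hμ => ?_⟩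
    · obtain ⟨n, hn⟩ := h x hx y hy.1
      obtain ⟨m, hm⟩ := h x hx _ (jump_mem hT₂.isClosed hy.1)
      obtain ⟨k, hk⟩ := hχ y hy
      refine ⟨n + m + k, ?_⟩
      simp only [alpha, shiftY]
      push_cast
      rw [hn, hm, hk]
      ring
    · -- the function `sin ((φ̃ + φ - 2 θ - χ) / 2)` vanishes on `T₁`, and its derivative is a
      -- non-zero multiple of the defect
      have hj := grain_eq_zero_iff.1 hμ
      have h1 := (hasDeltaDerivAt_iff_hasDerivWithinAt hj).1
        (hasDeltaDerivAt_defect hφ hφ' hθ hx hy)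
      have h2 := ((h1.sub_const (χ y)).div_const 2).sin
      have harg : ∀ s ∈ T₁, ∃ n : ℤ, (φ' s y + φ s y - 2 * θ s y - χ y) / 2 =
          n * (2 * Real.pi) := by
        intro s hs
        obtain ⟨n, hn⟩ := h s hs y hy
        exact ⟨n, by rw [hn]; ring⟩
      have h3 := h2.congr_of_mem (f₁ := fun _ => (0 : ℝ)) (fun s hs => by
        obtain ⟨n, hn⟩ := harg s hs
        rw [hn]
        simpa using (Real.sin_add_int_mul_two_pi 0 n).symm) hx.1
      have h4 := ((hasDeltaDerivAt_iff_hasDerivWithinAt hj).2 h3).unique hx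
        (hasDeltaDerivAt_const 0)
      obtain ⟨n, hn⟩ := harg x hx.1
      rw [hn, Real.cos_int_mul_two_pi] at h4
      linarith
    · have hj : jump T₁ x ≠ x := fun h => hμ (grain_eq_zero_iff.2 h)
      have h1 := (hasDeltaDerivAt_defect hφ hφ' hθ hx hy).sub_eq hx.1 hj
      obtain ⟨n, hn⟩ := h x hx.1 y hy
      obtain ⟨m, hm⟩ := h _ (jump_mem hT₁.isClosed hx.1) y hy
      simp only [smul_eq_mul] at h1
      refine ⟨m - n, ?_⟩
      rw [hn, hm] at h1
      push_cast
      field_simp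
      linarith

theorem derivX_add_eq (T₁ : Set ℝ) (ψ : ℝ → ℝ → ℝ) (χ : ℝ → ℝ) (x y : ℝ) :
    derivX T₁ (fun s t => ψ s t + χ t) x y = derivX T₁ ψ x y := by
  have h : HasDeltaDerivAt T₁ (fun s => ψ s y + χ y) = HasDeltaDerivAt T₁ (fun s => ψ s y) := by
    funext a t
    simp only [HasDeltaDerivAt, add_sub_add_right_eq_sub]
  unfold derivX deltaDeriv
  rw [h]

theorem alpha_add_eq {ψ : ℝ → ℝ → ℝ} {χ : ℝ → ℝ} {y : ℝ} (h : χ (jump T₂ y) = -χ y) (x : ℝ) :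
    alpha T₂ (fun s t => ψ s t + χ t) x y = alpha T₂ ψ x y := by
  simp only [alpha, shiftY, h]
  ring

end System

end TimeScaleSG

theorem mainTheorem3 (T₁ T₂ : Set ℝ) (hT₁ : TimeScaleSG.IsTimeScale T₁)
    (hT₂ : TimeScaleSG.IsTimeScale T₂) (κ : ℝ) (hκ : κ ≠ 0) (φ φ' θ : ℝ → ℝ → ℝ)
    (hφ : TimeScaleSG.DifferentiableX T₁ T₂ φ)
    (hφ' : TimeScaleSG.DifferentiableX T₁ T₂ φ')
    (hθ : TimeScaleSG.DifferentiableX T₁ T₂ θ)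
    (hdyn : TimeScaleSG.IsKernelTheta T₁ T₂ κ φ θ ∨ TimeScaleSG.IsDynTheta T₁ T₂ κ φ θ) :
    -- the transformation is equivalent to the system (for the angles modulo `2π`)
    (TimeScaleSG.IsDBT T₁ T₂ κ θ (TimeScaleSG.laxCoeffs T₁ T₂ φ) (TimeScaleSG.laxCoeffs T₁ T₂ φ') ↔
      TimeScaleSG.IsSystemMod T₁ T₂ φ φ' θ) ∧
    -- in particular the exact system implies the transformation
    (TimeScaleSG.IsSystem T₁ T₂ φ φ' θ →
      TimeScaleSG.IsDBT T₁ T₂ κ θ (TimeScaleSG.laxCoeffs T₁ T₂ φ)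
        (TimeScaleSG.laxCoeffs T₁ T₂ φ')) ∧
    -- the exact system says `φ' = 2 θ - φ + χ(y)` with `χ^{σ_y} = -χ`
    (TimeScaleSG.IsSystem T₁ T₂ φ φ' θ ↔
      ∃ χ : ℝ → ℝ, (∀ y ∈ TimeScaleSG.kappaSet T₂, χ (TimeScaleSG.jump T₂ y) = -χ y) ∧
        ∀ x ∈ T₁, ∀ y ∈ T₂, φ' x y = 2 * θ x y - φ x y + χ y) ∧
    -- the transformation itself says the same modulo `4π` (half of `φ` is an angle)
    (TimeScaleSG.IsDBT T₁ T₂ κ θ (TimeScaleSG.laxCoeffs T₁ T₂ φ) (TimeScaleSG.laxCoeffs T₁ T₂ φ') ↔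
      ∃ χ : ℝ → ℝ, (∀ y ∈ TimeScaleSG.kappaSet T₂, ∃ n : ℤ,
          χ (TimeScaleSG.jump T₂ y) = -χ y + 4 * Real.pi * n) ∧
        ∀ x ∈ T₁, ∀ y ∈ T₂, ∃ n : ℤ,
          φ' x y = 2 * θ x y - φ x y + χ y + 4 * Real.pi * n) ∧
    -- adding such a `χ` to a potential does not change the Lax pair
    (∀ (ψ : ℝ → ℝ → ℝ) (χ : ℝ → ℝ),
      (∀ y ∈ TimeScaleSG.kappaSet T₂, χ (TimeScaleSG.jump T₂ y) = -χ y) →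
        (∀ ζ : ℂ, ζ ≠ 0 → ∀ x ∈ TimeScaleSG.kappaSet T₁, ∀ y ∈ T₂,
          TimeScaleSG.laxU T₁ (fun s t => ψ s t + χ t) ζ x y = TimeScaleSG.laxU T₁ ψ ζ x y) ∧
        (∀ ζ : ℂ, ζ ≠ 0 → ∀ x ∈ T₁, ∀ y ∈ TimeScaleSG.kappaSet T₂,
          TimeScaleSG.laxV T₂ (fun s t => ψ s t + χ t) ζ x y =
            TimeScaleSG.laxV T₂ ψ ζ x y)) := by
  have hX : ∀ x ∈ TimeScaleSG.kappaSet T₁, ∀ y ∈ T₂, TimeScaleSG.XEquation T₁ κ φ θ x y := by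
    intro x hx y hy
    rcases hdyn with h | h
    · exact h.xEquation hT₁.isClosed hθ hx hy
    · exact h.xEquation hx hy
  have hD := TimeScaleSG.isDBT_iff_isSystemMod (φ' := φ') hθ hX
  refine ⟨hD, fun h => hD.2 h.isSystemMod, TimeScaleSG.isSystem_iff hT₁ hT₂ hφ hφ' hθ,
    hD.trans (TimeScaleSG.isSystemMod_iff hT₁ hT₂ hφ hφ' hθ), fun ψ χ hχ => ⟨?_, ?_⟩⟩
  · intro ζ _ x _ y _
    simp only [TimeScaleSG.laxU, TimeScaleSG.delta, TimeScaleSG.derivX_add_eq]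
  · intro ζ _ x _ y hy
    simp only [TimeScaleSG.laxV, TimeScaleSG.alpha_add_eq (hχ y hy)]
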